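/- Let $A\to M$ be a smooth real vector bundle of finite rank over a smooth (finite-dimensional, Hausdorff, second countable) manifold $M$ without boundary, equipped with a Lie algebroid structure, i.e. an anchor $\rho:A\to TM$ (a smooth vector bundle morphism) and a Lie bracket $[\cdot,\cdot]$ on $\Gamma(A)$ such that $[X,fY]=f[X,Y]+(\rho(X)f)\,Y$ for $X,Y\in\Gamma(A)$, $f\in C^\infty(M)$. Let $d$ be the Lie algebroid differential on sections of $\wedge^\bullet A^*$, and use the Schouten bracket on sections of $\wedge^\bullet A$. For a bivector $\pi\in\Gamma(\wedge^2A)$ let $\pi^\sharp:A^*\to A$, $\pi^\sharp\alpha=i_\alpha\pi$; for a $2$-form $\omega\in\Gamma(\wedge^2A^*)$ let $\omega^\flat:A\to A^*$, $\omega^\flat X=-i_X\omega$. Let $N$ denote a $(1,1)$-tensor, i.e. a smooth bundle endomorphism of $A$, with transpose $N^*:A^*\to A^*$. If $\omega^\flat\circ N=N^*\circ\omega^\flat$, let $\omega_N$ be the $2$-form with $(\omega_N)^\flat=\omega^\flat\circ N$; the condition holds in particular for $N=\pi^\sharp\circ\omega^\flat$. A pair $(\pi,\omega)$ is a $P\Omega$-structure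 if $[\pi,\pi]=0$, $d\omega=0$ and $d(\omega_N)=0$, where $N=\pi^\sharp\circ\omega^\flat$. A pair $(\omega,N)$ is an $\Omega N$-structure if $\omega^\flat\circ N=N^*\circ\omega^\flat$, $d\omega=0$, $d(\omega_N)=0$ and the Nijenhuis torsion of $N$ vanishes, i.e. $[NX,NY]-N([NX,Y]+[X,NY])+N^2[X,Y]=0$ for all $X,Y\in\Gamma(A)$. Theorem. (1) If $(\pi,\omega)$ is a $P\Omega$-structure on $A$, then $(\omega,N)$ with $N=\pi^\sharp\circ\omega^\flat$ is an $\Omega N$-structure on $A$. (2) Conversely, if $(\omega,N)$ is an $\Omega N$-structure on $A$ and $\omega$ is non-degenerate, then $N\circ(\omega^\flat)^{-1}=\pi^\sharp$ for a smooth bivector $\pi$, and $(\pi,\omega)$ is a $P\Omega$-structure on $A$. -/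

import Mathlib

open Bundle
open scoped Manifold ContDiff

noncomputable section

namespace LieAlgebroidGeometry

section Composition

variable {E : Type*} [NormedAddCommGroup E] [NormedSpace ℝ E]
  {H : Type*} [TopologicalSpace H] {I : ModelWithCorners ℝ E H}
  {M : Type*} [TopologicalSpace M] [ChartedSpace H M]
  {F₁ : Type*} [NormedAddCommGroup F₁] [NormedSpace ℝ F₁]
  {V₁ : M → Type*} [∀ x, AddCommGroup (V₁ x)] [∀ x, Module ℝ (V₁ x)]
  [TopologicalSpace (TotalSpace F₁ V₁)] [∀ x, TopologicalSpace (V₁ x)]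
  [FiberBundle F₁ V₁] [VectorBundle ℝ F₁ V₁]
  {F₂ : Type*} [NormedAddCommGroup F₂] [NormedSpace ℝ F₂]
  {V₂ : M → Type*} [∀ x, AddCommGroup (V₂ x)] [∀ x, Module ℝ (V₂ x)]
  [TopologicalSpace (TotalSpace F₂ V₂)] [∀ x, TopologicalSpace (V₂ x)]
  [∀ x, IsTopologicalAddGroup (V₂ x)] [∀ x, ContinuousSMul ℝ (V₂ x)]
  [FiberBundle F₂ V₂] [VectorBundle ℝ F₂ V₂]
  {F₃ : Type*} [NormedAddCommGroup F₃] [NormedSpace ℝ F₃]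
  {V₃ : M → Type*} [∀ x, AddCommGroup (V₃ x)] [∀ x, Module ℝ (V₃ x)]
  [TopologicalSpace (TotalSpace F₃ V₃)] [∀ x, TopologicalSpace (V₃ x)]
  [∀ x, IsTopologicalAddGroup (V₃ x)] [∀ x, ContinuousSMul ℝ (V₃ x)]
  [FiberBundle F₃ V₃] [VectorBundle ℝ F₃ V₃]

/-- The composition `g ∘ f` of smooth vector bundle morphisms over the identity of `M`. -/
def compMorphism (g : Cₛ^∞⟮I; F₂ →L[ℝ] F₃, fun x => V₂ x →L[ℝ] V₃ x⟯)
    (f : Cₛ^∞⟮I; F₁ →L[ℝ] F₂, fun x => V₁ x →L[ℝ] V₂ x⟯) :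
    Cₛ^∞⟮I; F₁ →L[ℝ] F₃, fun x => V₁ x →L[ℝ] V₃ x⟯ where
  toFun x := (g x).comp (f x)
  contMDiff_toFun := by
    intro x₀
    have hf := (contMDiffAt_hom_bundle _).1 (f.contMDiff x₀)
    have hg := (contMDiffAt_hom_bundle _).1 (g.contMDiff x₀)
    refine (contMDiffAt_hom_bundle _).2 ⟨hf.1, ?_⟩
    refine (hg.2.clm_comp hf.2).congr_of_eventuallyEq ?_
    filter_upwards [(trivializationAt F₂ V₂ x₀).open_baseSet.mem_nhds
      (FiberBundle.mem_baseSet_trivializationAt' x₀)] with x hx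
    ext v
    simp only [ContinuousLinearMap.inCoordinates, ContinuousLinearMap.comp_apply,
      Trivialization.symmL_continuousLinearMapAt _ hx]

/-- The negative `-f` of a smooth vector bundle morphism. -/
def negMorphism (f : Cₛ^∞⟮I; F₁ →L[ℝ] F₂, fun x => V₁ x →L[ℝ] V₂ x⟯) :
    Cₛ^∞⟮I; F₁ →L[ℝ] F₂, fun x => V₁ x →L[ℝ] V₂ x⟯ where
  toFun x := -f x
  contMDiff_toFun := f.contMDiff.neg_section

/-- The image `f(X)` of a smooth section `X` under a smooth vector bundle morphism `f`. -/
def applyMorphism (f : Cₛ^∞⟮I; F₁ →L[ℝ] F₂, fun x => V₁ x →L[ℝ] V₂ x⟯) (X : Cₛ^∞⟮I; F₁, V₁⟯) :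
    Cₛ^∞⟮I; F₂, V₂⟯ where
  toFun x := f x (X x)
  contMDiff_toFun := f.contMDiff.clm_bundle_apply X.contMDiff

/-- The product `f X` of a smooth function and a smooth section. -/
def smulSection (f : C^∞⟮I, M; 𝓘(ℝ, ℝ), ℝ⟯) (X : Cₛ^∞⟮I; F₁, V₁⟯) : Cₛ^∞⟮I; F₁, V₁⟯ where
  toFun x := f x • X x
  contMDiff_toFun := f.contMDiff.smul_section X.contMDiff

end Composition

variable {E : Type*} [NormedAddCommGroup E] [NormedSpace ℝ E]
  {H : Type*} [TopologicalSpace H] (I : ModelWithCorners ℝ E H)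
  {M : Type*} [TopologicalSpace M] [ChartedSpace H M]
  (F : Type*) [NormedAddCommGroup F] [NormedSpace ℝ F]
  (V : M → Type*) [∀ x, AddCommGroup (V x)] [∀ x, Module ℝ (V x)]
  [TopologicalSpace (TotalSpace F V)] [∀ x, TopologicalSpace (V x)]
  [∀ x, IsTopologicalAddGroup (V x)] [∀ x, ContinuousSMul ℝ (V x)]
  [FiberBundle F V] [VectorBundle ℝ F V]

/-- `Γ(A)`, the smooth sections of the vector bundle `A = V`. -/
abbrev Sections := Cₛ^∞⟮I; F, V⟯

/-- `1`-forms on the vector bundle `A = V`: smooth sections of `A*`. -/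
abbrev OneForm := Cₛ^∞⟮I; F →L[ℝ] ℝ, fun x => V x →L[ℝ] ℝ⟯

/-- `(1,1)`-tensors on `A = V`: smooth sections of `A* ⊗ A = Hom(A, A)`. -/
abbrev Tensor11 := Cₛ^∞⟮I; F →L[ℝ] F, fun x => V x →L[ℝ] V x⟯

/-- `2`-forms on `A = V`: smooth families of alternating bilinear forms on the fibres of `A`. -/
structure TwoForm where
  /-- `form x v w` is `Ω(v, w)` for `v w : A_x`. -/
  form : Cₛ^∞⟮I; F →L[ℝ] F →L[ℝ] ℝ, fun x => V x →L[ℝ] V x →L[ℝ] ℝ⟯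
  alternating : ∀ (x : M) (v : V x), form x v v = 0

/-- Bivectors on `A = V`, that is, sections of `∧² A`. As `A` has finite rank, a bivector `P` is the
same as an alternating bilinear form on the fibres of `A*`, and as the skew-symmetric bundle map
`P♯ : A* → A` with `P(α, β) = β(P♯ α)`, that is `P♯ α = i_α P`. It is recorded by `P♯`. -/
structure Bivector where
  /-- The bundle map `P♯ : A* → A`. -/
  sharp : Cₛ^∞⟮I; (F →L[ℝ] ℝ) →L[ℝ] F, fun x => (V x →L[ℝ] ℝ) →L[ℝ] V x⟯
  alternating : ∀ (x : M) (α : V x →L[ℝ] ℝ), α (sharp x α) = 0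

/-- A Lie algebroid structure on the vector bundle `A = V`: an anchor `ρ : A → TM` and a Lie bracket
on `Γ(A)` satisfying the Leibniz rule. -/
structure LieAlgebroid [IsManifold I ∞ M] where
  /-- The anchor, a smooth bundle map `A → TM`. -/
  anchor : Cₛ^∞⟮I; F →L[ℝ] E, fun x => V x →L[ℝ] TangentSpace I x⟯
  /-- The `ℝ`-bilinear bracket of sections. -/
  bracket : Sections I F V →ₗ[ℝ] Sections I F V →ₗ[ℝ] Sections I F V
  bracket_self : ∀ X, bracket X X = 0
  jacobi : ∀ X Y Z,
    bracket X (bracket Y Z) + bracket Y (bracket Z X) + bracket Z (bracket X Y) = 0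
  leibniz : ∀ (X Y : Sections I F V) (f : C^∞⟮I, M; 𝓘(ℝ, ℝ), ℝ⟯) (x : M),
    bracket X (smulSection f Y) x =
      f x • bracket X Y x + (show ℝ from mfderiv I 𝓘(ℝ, ℝ) f x (anchor x (X x))) • Y x

variable {I F V}

namespace TwoForm

/-- `Ω♭ : A → A*`, with the sign convention `Ω♭ X = - i_X Ω`. -/
def flat (Ω : TwoForm I F V) : Cₛ^∞⟮I; F →L[ℝ] F →L[ℝ] ℝ, fun x => V x →L[ℝ] V x →L[ℝ] ℝ⟯ :=
  negMorphism Ω.form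

/-- The function `Ω(X, Y)`. -/
def eval (Ω : TwoForm I F V) (X Y : Sections I F V) (x : M) : ℝ := Ω.form x (X x) (Y x)

/-- `Ω` is non-degenerate. -/
def Nondegenerate (Ω : TwoForm I F V) : Prop :=
  ∀ (x : M) (v : V x), (∀ w : V x, Ω.form x v w = 0) → v = 0

/-- The condition `Ω♭ ∘ N = N* ∘ Ω♭`, where `N* φ = φ ∘ N`. -/
def Commutes (Ω : TwoForm I F V) (N : Tensor11 I F V) : Prop :=
  ∀ (x : M) (v : V x), Ω.flat x (N x v) = (Ω.flat x v).comp (N x)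

theorem flat_apply (Ω : TwoForm I F V) (x : M) (v w : V x) :
    Ω.flat x v w = -Ω.form x v w := rfl

theorem form_swap (Ω : TwoForm I F V) (x : M) (v w : V x) :
    Ω.form x v w = -Ω.form x w v := by
  have h := Ω.alternating x (v + w)
  simp only [map_add, add_apply, Ω.alternating] at h
  linarith

/-- The `2`-form `Ω_N` with `(Ω_N)♭ = Ω♭ ∘ N`, that is `Ω_N(X, Y) = Ω(N X, Y)`. -/
def deform (Ω : TwoForm I F V) (N : Tensor11 I F V) (h : Ω.Commutes N) : TwoForm I F V where
  form := compMorphism Ω.form N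
  alternating x v := by
    have h1 := congrArg (fun φ : V x →L[ℝ] ℝ => φ v) (h x v)
    simp only [flat_apply, ContinuousLinearMap.comp_apply] at h1
    have h2 := Ω.form_swap x (N x v) v
    change Ω.form x (N x v) v = 0
    linarith

theorem deform_flat (Ω : TwoForm I F V) (N : Tensor11 I F V) (h : Ω.Commutes N) (x : M) :
    (Ω.deform N h).flat x = (Ω.flat x).comp (N x) := rfl

end TwoForm

namespace Bivector

/-- The function `P(α, β) = β(P♯ α)`. -/
def eval (P : Bivector I F V) (α β : OneForm I F V) (x : M) : ℝ := β x (P.sharp x (α x))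

/-- The `(1,1)`-tensor `P♯ ∘ Ω♭`. -/
def compFlat (P : Bivector I F V) (Ω : TwoForm I F V) : Tensor11 I F V :=
  compMorphism P.sharp Ω.flat

theorem apply_sharp_swap (P : Bivector I F V) (x : M) (α β : V x →L[ℝ] ℝ) :
    α (P.sharp x β) = -β (P.sharp x α) := by
  have h := P.alternating x (α + β)
  simp only [map_add, add_apply, P.alternating] at h
  linarith

theorem commutes_compFlat (P : Bivector I F V) (Ω : TwoForm I F V) :
    Ω.Commutes (P.compFlat Ω) := by
  intro x v
  ext w
  change Ω.flat x (P.sharp x (Ω.flat x v)) w = Ω.flat x v (P.sharp x (Ω.flat x w))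
  rw [P.apply_sharp_swap, TwoForm.flat_apply, TwoForm.flat_apply, Ω.form_swap]

end Bivector

namespace LieAlgebroid

variable [IsManifold I ∞ M] (L : LieAlgebroid I F V)

/-- The derivative `ρ(X) f` of a function along a section. -/
def deriv (X : Sections I F V) (f : M → ℝ) (x : M) : ℝ :=
  mfderiv I 𝓘(ℝ, ℝ) f x (L.anchor x (X x))

/-- The Lie algebroid differential of a `2`-form, evaluated on three sections. -/
def dTwo (Ω : TwoForm I F V) (X Y Z : Sections I F V) (x : M) : ℝ :=
  L.deriv X (Ω.eval Y Z) x - L.deriv Y (Ω.eval X Z) x + L.deriv Z (Ω.eval X Y) x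
    - Ω.eval (L.bracket X Y) Z x + Ω.eval (L.bracket X Z) Y x - Ω.eval (L.bracket Y Z) X x

/-- `d Ω = 0`. -/
def IsClosed (Ω : TwoForm I F V) : Prop := ∀ X Y Z x, L.dTwo Ω X Y Z x = 0

/-- The function `⟨ℒ_X β, Y⟩ = ρ(X)⟨β, Y⟩ - ⟨β, [X, Y]⟩`, for the Lie derivative of a `1`-form. -/
def lieDeriv (X : Sections I F V) (β : OneForm I F V) (Y : Sections I F V) (x : M) : ℝ :=
  L.deriv X (fun y => β y (Y y)) x - β x (L.bracket X Y x)

/-- The Schouten bracket `[P, P]` of a bivector with itself, a trivector, evaluated on three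
`1`-forms: `2 (⟨ℒ_{P♯ α} β, P♯ γ⟩ + ⟨ℒ_{P♯ β} γ, P♯ α⟩ + ⟨ℒ_{P♯ γ} α, P♯ β⟩)`. For `A = TM` and
coordinate `1`-forms these are the components
`2 (P^{kl} ∂_l P^{ij} + P^{il} ∂_l P^{jk} + P^{jl} ∂_l P^{ki})`. -/
def schoutenSelf (P : Bivector I F V) (α β γ : OneForm I F V) (x : M) : ℝ :=
  2 * (L.lieDeriv (applyMorphism P.sharp α) β (applyMorphism P.sharp γ) x
    + L.lieDeriv (applyMorphism P.sharp β) γ (applyMorphism P.sharp α) x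
    + L.lieDeriv (applyMorphism P.sharp γ) α (applyMorphism P.sharp β) x)

/-- `P` is a Poisson bivector: `[P, P] = 0`. -/
def IsPoisson (P : Bivector I F V) : Prop := ∀ α β γ x, L.schoutenSelf P α β γ x = 0

/-- The Nijenhuis torsion `(T N)(X, Y) = [NX, NY] - N([NX, Y] + [X, NY]) + N²[X, Y]`. -/
def torsion (N : Tensor11 I F V) (X Y : Sections I F V) : Sections I F V :=
  L.bracket (applyMorphism N X) (applyMorphism N Y)
    - applyMorphism N (L.bracket (applyMorphism N X) Y + L.bracket X (applyMorphism N Y))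
    + applyMorphism N (applyMorphism N (L.bracket X Y))

/-- `N` is a Nijenhuis tensor: its torsion vanishes. -/
def IsNijenhuis (N : Tensor11 I F V) : Prop := ∀ X Y, L.torsion N X Y = 0

/-- `(P, Ω)` is a `PΩ`-structure: `P` is Poisson, `d Ω = 0` and `d(Ω_N) = 0`,
where `N = P♯ ∘ Ω♭`. -/
structure IsPOmega (P : Bivector I F V) (Ω : TwoForm I F V) : Prop where
  poisson : L.IsPoisson P
  closed : L.IsClosed Ω
  deform_closed : L.IsClosed (Ω.deform (P.compFlat Ω) (P.commutes_compFlat Ω))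

/-- `(Ω, N)` is an `ΩN`-structure: `Ω♭ ∘ N = N* ∘ Ω♭`, `d Ω = 0`, `N` is Nijenhuis and
`d(Ω_N) = 0`. -/
structure IsOmegaN (Ω : TwoForm I F V) (N : Tensor11 I F V) : Prop where
  commutes : Ω.Commutes N
  closed : L.IsClosed Ω
  nijenhuis : L.IsNijenhuis N
  deform_closed : L.IsClosed (Ω.deform N commutes)

end LieAlgebroid

end LieAlgebroidGeometry

end

noncomputable section

namespace LieAlgebroidGeometry

section GlobalSections

variable {E : Type*} [NormedAddCommGroup E] [NormedSpace ℝ E] [FiniteDimensional ℝ E]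
  {H : Type*} [TopologicalSpace H] (I : ModelWithCorners ℝ E H)
  {M : Type*} [TopologicalSpace M] [ChartedSpace H M] [IsManifold I ∞ M] [T2Space M]
  (F : Type*) [NormedAddCommGroup F] [NormedSpace ℝ F]
  {V : M → Type*} [∀ x, AddCommGroup (V x)] [∀ x, Module ℝ (V x)]
  [TopologicalSpace (TotalSpace F V)] [∀ x, TopologicalSpace (V x)]
  [FiberBundle F V] [VectorBundle ℝ F V] [ContMDiffVectorBundle ∞ F V I]

/-- Every point of a smooth vector bundle lies on a global smooth section. -/
theorem exists_section_eq {x : M} (v : V x) : ∃ X : Cₛ^∞⟮I; F, V⟯, X x = v := by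
  obtain ⟨s, hs, hX⟩ := FiberBundle.exists_contMDiffOn_extend (k := ∞) I F v
  obtain ⟨u, hus, hu, hxu⟩ := mem_nhds_iff.1 hs
  obtain ⟨f, hf⟩ := ((SmoothBumpFunction.nhds_basis_tsupport (I := I) x).mem_iff).1
    (hu.mem_nhds hxu)
  refine ⟨⟨fun y => f y • FiberBundle.extend F v y,
    ContMDiffOn.smul_section_of_tsupport f.contMDiff.contMDiffOn hu hf.2 (hX.mono hus)⟩, ?_⟩
  change f x • FiberBundle.extend F v x = v
  rw [f.eq_one, one_smul, FiberBundle.extend_apply_self]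

end GlobalSections

/-- The continuous linear functionals on a fibre of a vector bundle separate points. -/
theorem eq_zero_of_forall_dual_fiber {M : Type*} [TopologicalSpace M]
    (F : Type*) [NormedAddCommGroup F] [NormedSpace ℝ F]
    {V : M → Type*} [∀ x, AddCommGroup (V x)] [∀ x, Module ℝ (V x)]
    [TopologicalSpace (TotalSpace F V)] [∀ x, TopologicalSpace (V x)]
    [FiberBundle F V] [VectorBundle ℝ F V] {x : M} (v : V x) (h : ∀ φ : V x →L[ℝ] ℝ, φ v = 0) :
    v = 0 := by
  let e := (trivializationAt F V x).continuousLinearEquivAt ℝ x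
    (FiberBundle.mem_baseSet_trivializationAt' x)
  refine e.map_eq_zero_iff.1 ?_
  by_contra hv
  obtain ⟨φ, hφ⟩ := SeparatingDual.exists_ne_zero (R := ℝ) hv
  exact hφ (h (φ.comp (e : V x →L[ℝ] F)))

section Inverse

/-- An injective continuous linear map from a finite-dimensional space to its dual is invertible. -/
theorem isInvertible_of_injective_dual {F : Type*} [NormedAddCommGroup F] [NormedSpace ℝ F]
    [FiniteDimensional ℝ F] (c : F →L[ℝ] F →L[ℝ] ℝ) (hc : Function.Injective c) :
    c.IsInvertible := by
  have hd : Module.finrank ℝ F = Module.finrank ℝ (F →L[ℝ] ℝ) := by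
    rw [← (LinearMap.toContinuousLinearMap (𝕜 := ℝ) (E := F) (F' := ℝ)).finrank_eq]
    exact Subspace.dual_finrank_eq.symm
  exact ⟨(LinearEquiv.ofInjectiveOfFinrankEq c.toLinearMap hc hd).toContinuousLinearEquiv,
    ContinuousLinearMap.ext fun _ => rfl⟩

variable {E : Type*} [NormedAddCommGroup E] [NormedSpace ℝ E]
  {H : Type*} [TopologicalSpace H] {I : ModelWithCorners ℝ E H}
  {M : Type*} [TopologicalSpace M] [ChartedSpace H M]
  {F₁ : Type*} [NormedAddCommGroup F₁] [NormedSpace ℝ F₁]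
  {V₁ : M → Type*} [∀ x, AddCommGroup (V₁ x)] [∀ x, Module ℝ (V₁ x)]
  [TopologicalSpace (TotalSpace F₁ V₁)] [∀ x, TopologicalSpace (V₁ x)]
  [∀ x, IsTopologicalAddGroup (V₁ x)] [∀ x, ContinuousSMul ℝ (V₁ x)]
  [FiberBundle F₁ V₁] [VectorBundle ℝ F₁ V₁]
  {F₂ : Type*} [NormedAddCommGroup F₂] [NormedSpace ℝ F₂]
  {V₂ : M → Type*} [∀ x, AddCommGroup (V₂ x)] [∀ x, Module ℝ (V₂ x)]
  [TopologicalSpace (TotalSpace F₂ V₂)] [∀ x, TopologicalSpace (V₂ x)]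
  [∀ x, IsTopologicalAddGroup (V₂ x)] [∀ x, ContinuousSMul ℝ (V₂ x)]
  [FiberBundle F₂ V₂] [VectorBundle ℝ F₂ V₂]

/-- The inverse of a fibrewise invertible smooth vector bundle morphism. -/
def inverseMorphism [CompleteSpace F₁]
    (f : Cₛ^∞⟮I; F₁ →L[ℝ] F₂, fun x => V₁ x →L[ℝ] V₂ x⟯) (hf : ∀ x, (f x).IsInvertible) :
    Cₛ^∞⟮I; F₂ →L[ℝ] F₁, fun x => V₂ x →L[ℝ] V₁ x⟯ where
  toFun x := (f x).inverse
  contMDiff_toFun := by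
    intro x₀
    have h := (contMDiffAt_hom_bundle _).1 (f.contMDiff x₀)
    have h₁ := FiberBundle.mem_baseSet_trivializationAt' (F := F₁) (E := V₁) x₀
    have h₂ := FiberBundle.mem_baseSet_trivializationAt' (F := F₂) (E := V₂) x₀
    refine (contMDiffAt_hom_bundle _).2 ⟨h.1, ?_⟩
    have hinv : (ContinuousLinearMap.inCoordinates F₁ V₁ F₂ V₂ x₀ x₀ x₀ x₀ (f x₀)).IsInvertible := by
      rw [ContinuousLinearMap.inCoordinates_eq h₁ h₂]
      simpa using hf x₀
    refine ((hinv.contDiffAt_map_inverse (n := ∞)).contMDiffAt.comp x₀ h.2).congr_of_eventuallyEq ?_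
    filter_upwards [(trivializationAt F₁ V₁ x₀).open_baseSet.mem_nhds h₁,
      (trivializationAt F₂ V₂ x₀).open_baseSet.mem_nhds h₂] with x hx₁ hx₂
    simp only [Function.comp_apply]
    rw [ContinuousLinearMap.inCoordinates_eq hx₁ hx₂, ContinuousLinearMap.inCoordinates_eq hx₂ hx₁,
      ContinuousLinearMap.inverse_equiv_comp, ContinuousLinearMap.inverse_comp_equiv,
      ContinuousLinearEquiv.symm_symm, ContinuousLinearMap.comp_assoc]

end Inverse

variable {E : Type*} [NormedAddCommGroup E] [NormedSpace ℝ E]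
  {H : Type*} [TopologicalSpace H] {I : ModelWithCorners ℝ E H}
  {M : Type*} [TopologicalSpace M] [ChartedSpace H M]
  {F : Type*} [NormedAddCommGroup F] [NormedSpace ℝ F]
  {V : M → Type*} [∀ x, AddCommGroup (V x)] [∀ x, Module ℝ (V x)]
  [TopologicalSpace (TotalSpace F V)] [∀ x, TopologicalSpace (V x)]
  [∀ x, IsTopologicalAddGroup (V x)] [∀ x, ContinuousSMul ℝ (V x)]
  [FiberBundle F V] [VectorBundle ℝ F V]

theorem TwoForm.Nondegenerate.isInvertible_flat [FiniteDimensional ℝ F] {Ω : TwoForm I F V}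
    (hΩ : Ω.Nondegenerate) (x : M) : (Ω.flat x).IsInvertible := by
  have hinj : Function.Injective (Ω.flat x) := by
    refine (injective_iff_map_eq_zero _).2 fun v hv => hΩ x v fun w => ?_
    have := congrArg (fun φ : V x →L[ℝ] ℝ => φ w) hv
    simpa [TwoForm.flat_apply] using this
  let e := (trivializationAt F V x).continuousLinearEquivAt ℝ x
    (FiberBundle.mem_baseSet_trivializationAt' x)
  let e' : (V x →L[ℝ] ℝ) ≃L[ℝ] (F →L[ℝ] ℝ) :=
    e.arrowCongr (ContinuousLinearEquiv.refl ℝ ℝ)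
  have h := isInvertible_of_injective_dual
    ((e' : (V x →L[ℝ] ℝ) →L[ℝ] (F →L[ℝ] ℝ)).comp ((Ω.flat x).comp (e.symm : F →L[ℝ] V x)))
    (e'.injective.comp (hinj.comp e.symm.injective))
  simpa using h

namespace LieAlgebroid

variable [IsManifold I ∞ M] (L : LieAlgebroid I F V)

theorem deriv_neg (X : Sections I F V) (f : M → ℝ) (x : M) :
    L.deriv X (fun y => -f y) x = -L.deriv X f x := by
  change (mfderiv I 𝓘(ℝ, ℝ) (-f) x) _ = _
  rw [mfderiv_neg]
  rfl

theorem bracket_swap (X Y : Sections I F V) : L.bracket X Y = -L.bracket Y X := by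
  have h := L.bracket_self (X + Y)
  simp only [map_add, LinearMap.add_apply, L.bracket_self, zero_add, add_zero] at h
  exact eq_neg_of_add_eq_zero_right h

/-- For closed `Ω` and `Ω_N`, where `N = P♯ ∘ Ω♭`, the Schouten bracket `[P, P]` on
`(Ω♭ X, Ω♭ Y, γ)` is twice the pairing of `γ` with the Nijenhuis torsion of `N`. -/
theorem schoutenSelf_flat_flat (P : Bivector I F V) (Ω : TwoForm I F V) (hΩ : L.IsClosed Ω)
    (hN : L.IsClosed (Ω.deform (P.compFlat Ω) (P.commutes_compFlat Ω)))
    (X Y : Sections I F V) (γ : OneForm I F V) (x : M) :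
    L.schoutenSelf P (applyMorphism Ω.flat X) (applyMorphism Ω.flat Y) γ x =
      2 * γ x (L.torsion (P.compFlat Ω) X Y x) := by
  set N := P.compFlat Ω
  set Z := applyMorphism P.sharp γ
  have hpair : ∀ (y : M) (w : V y), γ y (N y w) = Ω.form y w (Z y) := by
    intro y w
    change γ y (P.sharp y (Ω.flat y w)) = _
    rw [P.apply_sharp_swap, TwoForm.flat_apply, neg_neg]
    rfl
  have hcomm : ∀ (y : M) (v w : V y), Ω.form y (N y v) w = Ω.form y v (N y w) := by
    intro y v w
    have h := congrArg (fun φ : V y →L[ℝ] ℝ => φ w) (P.commutes_compFlat Ω y v)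
    simpa [TwoForm.flat_apply] using h
  have hcomm' : ∀ U W : Sections I F V,
      Ω.eval U (applyMorphism N W) = Ω.eval (applyMorphism N U) W :=
    fun U W => funext fun y => (hcomm y _ _).symm
  have d₁ := hΩ (applyMorphism N X) Y Z x
  have d₂ := hΩ X (applyMorphism N Y) Z x
  have d₃ := hN X Y Z x
  have e₁ : L.lieDeriv (applyMorphism N X) (applyMorphism Ω.flat Y) Z x =
      -L.deriv (applyMorphism N X) (Ω.eval Y Z) x
        - Ω.eval (L.bracket (applyMorphism N X) Z) Y x := by
    have : Ω.eval (L.bracket (applyMorphism N X) Z) Y x =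
        -Ω.form x (Y x) (L.bracket (applyMorphism N X) Z x) := Ω.form_swap x _ _
    rw [this, ← deriv_neg]
    rfl
  have e₂ : L.lieDeriv (applyMorphism N Y) γ (applyMorphism N X) x =
      L.deriv (applyMorphism N Y) (Ω.eval X Z) x
        + γ x (L.bracket (applyMorphism N X) (applyMorphism N Y) x) := by
    have h : (fun y => γ y (applyMorphism N X y)) = Ω.eval X Z := funext fun y => hpair y _
    have hb : L.bracket (applyMorphism N Y) (applyMorphism N X) x =
        -L.bracket (applyMorphism N X) (applyMorphism N Y) x := by
      rw [L.bracket_swap]; rfl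
    rw [lieDeriv, h, hb, map_neg, sub_neg_eq_add]
  have e₃ : L.lieDeriv Z (applyMorphism Ω.flat X) (applyMorphism N Y) x =
      -L.deriv Z (Ω.eval (applyMorphism N X) Y) x
        + Ω.eval (L.bracket (applyMorphism N Y) Z) X x := by
    have hb : L.bracket Z (applyMorphism N Y) x = -L.bracket (applyMorphism N Y) Z x := by
      rw [L.bracket_swap]; rfl
    have h : Ω.eval (L.bracket (applyMorphism N Y) Z) X x =
        -Ω.form x (X x) (L.bracket (applyMorphism N Y) Z x) := Ω.form_swap x _ _
    rw [lieDeriv, hb, map_neg, h, ← hcomm', ← deriv_neg, sub_neg_eq_add]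
    rfl
  have e₄ : γ x (L.torsion N X Y x) =
      γ x (L.bracket (applyMorphism N X) (applyMorphism N Y) x)
        - (Ω.eval (L.bracket (applyMorphism N X) Y) Z x
          + Ω.eval (L.bracket X (applyMorphism N Y)) Z x)
        + Ω.eval (applyMorphism N (L.bracket X Y)) Z x := by
    change γ x (_ - N x (_ + _) + N x (N x _)) = _
    rw [map_add, map_sub, map_add, map_add, hpair, hpair, hpair]
    rfl
  change 2 * (L.lieDeriv (applyMorphism N X) (applyMorphism Ω.flat Y) Z x
    + L.lieDeriv (applyMorphism N Y) γ (applyMorphism N X) x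
    + L.lieDeriv Z (applyMorphism Ω.flat X) (applyMorphism N Y) x) = _
  rw [e₁, e₂, e₃, e₄]
  have d₃' : L.deriv X (Ω.eval (applyMorphism N Y) Z) x
      - L.deriv Y (Ω.eval (applyMorphism N X) Z) x + L.deriv Z (Ω.eval (applyMorphism N X) Y) x
      - Ω.eval (applyMorphism N (L.bracket X Y)) Z x
      + Ω.eval (applyMorphism N (L.bracket X Z)) Y x
      - Ω.eval (applyMorphism N (L.bracket Y Z)) X x = 0 := d₃
  simp only [dTwo] at d₁ d₂
  rw [hcomm'] at d₁ d₂ d₂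
  linarith

end LieAlgebroid

end LieAlgebroidGeometry

end

theorem mainTheorem3
    {E : Type*} [NormedAddCommGroup E] [NormedSpace ℝ E] [FiniteDimensional ℝ E]
    {H : Type*} [TopologicalSpace H] (I : ModelWithCorners ℝ E H)
    {M : Type*} [TopologicalSpace M] [ChartedSpace H M] [IsManifold I ∞ M]
    [BoundarylessManifold I M] [T2Space M] [SecondCountableTopology M]
    (F : Type*) [NormedAddCommGroup F] [NormedSpace ℝ F] [FiniteDimensional ℝ F]
    (V : M → Type*) [∀ x, AddCommGroup (V x)] [∀ x, Module ℝ (V x)]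
    [TopologicalSpace (TotalSpace F V)] [∀ x, TopologicalSpace (V x)]
    [∀ x, IsTopologicalAddGroup (V x)] [∀ x, ContinuousSMul ℝ (V x)]
    [FiberBundle F V] [VectorBundle ℝ F V] [ContMDiffVectorBundle ∞ F V I]
    (L : LieAlgebroidGeometry.LieAlgebroid I F V) :
    (∀ (P : LieAlgebroidGeometry.Bivector I F V) (Ω : LieAlgebroidGeometry.TwoForm I F V),
      L.IsPOmega P Ω → L.IsOmegaN Ω (P.compFlat Ω)) ∧
    (∀ (Ω : LieAlgebroidGeometry.TwoForm I F V) (N : LieAlgebroidGeometry.Tensor11 I F V),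
      L.IsOmegaN Ω N → Ω.Nondegenerate →
        ∃ P : LieAlgebroidGeometry.Bivector I F V,
          (∀ x : M, P.sharp x = (N x).comp (Ω.flat x).inverse) ∧ L.IsPOmega P Ω) := by
  refine ⟨fun P Ω h => ⟨P.commutes_compFlat Ω, h.closed, fun X Y => ?_, h.deform_closed⟩,
    fun Ω N h hΩ => ?_⟩
  · ext x
    refine LieAlgebroidGeometry.eq_zero_of_forall_dual_fiber F _ fun φ => ?_
    obtain ⟨γ, rfl⟩ := LieAlgebroidGeometry.exists_section_eq I (F →L[ℝ] ℝ)
      (V := fun x => V x →L[ℝ] ℝ) φ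
    have h₁ := L.schoutenSelf_flat_flat P Ω h.closed h.deform_closed X Y γ x
    rw [h.poisson] at h₁
    linarith
  · have hinv := hΩ.isInvertible_flat
    let J := LieAlgebroidGeometry.inverseMorphism Ω.flat hinv
    let P : LieAlgebroidGeometry.Bivector I F V :=
      { sharp := LieAlgebroidGeometry.compMorphism N J
        alternating := by
          intro x α
          obtain ⟨v, rfl⟩ : ∃ v, Ω.flat x v = α :=
            ⟨(Ω.flat x).inverse α, (hinv x).self_apply_inverse α⟩
          change Ω.flat x v (N x ((Ω.flat x).inverse (Ω.flat x v))) = 0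
          rw [(hinv x).inverse_apply_self]
          have h₁ := (Ω.deform N h.commutes).alternating x v
          change Ω.form x (N x v) v = 0 at h₁
          rw [LieAlgebroidGeometry.TwoForm.flat_apply, Ω.form_swap, h₁, neg_neg] }
    have hPN : P.compFlat Ω = N := by
      ext x v
      change N x ((Ω.flat x).inverse (Ω.flat x v)) = N x v
      rw [(hinv x).inverse_apply_self]
    have hflat : ∀ α : LieAlgebroidGeometry.OneForm I F V,
        LieAlgebroidGeometry.applyMorphism Ω.flat (LieAlgebroidGeometry.applyMorphism J α) = α := by
      intro α
      ext x : 1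
      exact (hinv x).self_apply_inverse (α x)
    have hdef : L.IsClosed (Ω.deform (P.compFlat Ω) (P.commutes_compFlat Ω)) := by
      have := h.deform_closed
      simpa only [hPN] using this
    refine ⟨P, fun _ => rfl, ⟨fun α β γ x => ?_, h.closed, hdef⟩⟩
    have h₁ := L.schoutenSelf_flat_flat P Ω h.closed hdef
      (LieAlgebroidGeometry.applyMorphism J α) (LieAlgebroidGeometry.applyMorphism J β) γ x
    rw [hflat, hflat, hPN, h.nijenhuis] at h₁
    rw [h₁]
    change 2 * γ x 0 = 0
    rw [map_zero, mul_zero]
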